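/- Let $R$ and $S$ be associative rings with $1$, and let $M$ be a nonzero left $R$-module equipped with a right action of $S$ by $R$-endomorphisms (that is, a ring homomorphism from $S$ to $\mathrm{End}_R(M)$, endomorphisms being written on the right, so that $M$ is an $R$-$S$-bimodule). Let $E$ be an injective cogenerator for right $S$-modules: $E$ is an injective right $S$-module and, for every right $S$-module $X$ and every nonzero $x\in X$, there is an $S$-linear map $f:X\to E$ with $f(x)\neq 0$. Let $M^*=\mathrm{Hom}_S(M_S,E_S)$, a right $R$-module via $(f r)(m)=f(rm)$. Then $M^*$ has an indecomposable direct summand: there are $R$-submodules $N,N'\subseteq M^*$ with $M^*=N\oplus N'$ such that $N\neq 0$ and $N$ is not the direct sum of two nonzero submodules. -/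

import Mathlib

universe u v

/-- `E` is an injective cogenerator for left `T`-modules (take `T = Sᵐᵒᵖ` for right `S`-modules):
every linear map into `E` extends along every injective linear map, and for every module `X` the
linear maps `X → E` separate the nonzero elements of `X` from `0`. The test modules range over a
universe that contains (copies of) all ideals and cyclic modules of `T`, and `E` itself. -/
structure IsInjectiveCogenerator (T : Type u) [Ring T] (E : Type v) [AddCommGroup E]
    [Module T E] : Prop where
  extends_along_injective : ∀ (X Y : Type (max u v)) [AddCommGroup X] [AddCommGroup Y]
    [Module T X] [Module T Y] (i : X →ₗ[T] Y), Function.Injective i →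
    ∀ g : X →ₗ[T] E, ∃ h : Y →ₗ[T] E, h ∘ₗ i = g
  separates : ∀ (X : Type (max u v)) [AddCommGroup X] [Module T X] (x : X), x ≠ 0 →
    ∃ f : X →ₗ[T] E, f x ≠ 0

/-- A module is indecomposable if it is nonzero and is not the (internal) direct sum of two
nonzero submodules. -/
def IsIndecomposableModule (T : Type u) [Ring T] (N : Type v) [AddCommGroup N]
    [Module T N] : Prop :=
  Nontrivial N ∧ ∀ A B : Submodule T N, IsCompl A B → A = ⊥ ∨ B = ⊥

/-- The dual `Hom_S(M, E)` of an `R`-`S`-bimodule `M` with respect to a right `S`-module `E`.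
When `M` is a left `R`-module with commuting right `S`-action, Mathlib's module structure over
`Rᵈᵐᵃ` (a copy of the opposite ring `Rᵐᵒᵖ`) on linear maps is the right `R`-module structure
`(f · r) m = f (r • m)`. -/
abbrev HomDual (S : Type*) [Ring S] (M : Type*) [AddCommGroup M] [Module Sᵐᵒᵖ M]
    (E : Type*) [AddCommGroup E] [Module Sᵐᵒᵖ E] :=
  M →ₗ[Sᵐᵒᵖ] E

/-!
Write `X = Hom_S(M, E)` and `T = End_R(X)`. By the tensor-hom adjunction `T` is, as a set, the dual
`Hom_S(P, E)` of `P = X ⊗_R M`: an endomorphism `g` corresponds to the functional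
`x ⊗ m ↦ g x m`. Call a subset of `T` *closed* if it consists of all endomorphisms whose functional
has a prescribed restriction to some submodule of `P`. Since `E` is injective, such sets behave like
the closed sets of a compact space: a chain of closed sets has a closed nonempty intersection
(functionals on an increasing chain of submodules glue, and the result extends to `P`), and right
multiplication by an endomorphism maps closed sets to closed sets. The argument of the
Ellis–Numakura lemma therefore applies. Any closed subsemigroup `A` of `T` has a minimal closed left
ideal, which contains an idempotent `e`, and by minimality every `h ∈ A` satisfies `g * h * e = e`
for some `g ∈ A` (`exists_isIdempotentElem_forall_mul_mul_eq`).

This is applied to `A = {g | g f = f}` for a well-chosen `f ∈ X`. Fix `m₀ ≠ 0` in `M` and for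
`x ∈ X` put `V x = {m | x ⊗ m = 0}`. If `V x` is contained in the kernel of `y`, then `y` factors
through `m ↦ x ⊗ m`, so `y = g x` for some `g ∈ T` by injectivity, and hence `V x ≤ V y`
(`exists_end_apply_eq`). It follows that the submodules `V x` with `x m₀ ≠ 0` satisfy Zorn's
lemma; let `f` be such that `V f` is maximal (`exists_maximal_ker_tmul`).

The range of `e` is a direct summand of `X`, and it contains `f`. Suppose that it is the direct sum
of nonzero submodules `A₁` and `A₂`, and write `f = f₁ + f₂` accordingly. If `V f₂ ≤ ker f`, then
`f = g₀ f₂` for some `g₀`, so that `h = g₀ ∘ π₂` fixes `f` and kills `A₁`, which contradicts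
`g * h * e = e`. So `V f₂` is strictly larger than `V f`, and maximality gives `f₂ m₀ = 0`. By
symmetry `f₁ m₀ = 0`, and then `f m₀ = 0`, a contradiction.
-/

/-! ### Injective cogenerators in arbitrary universes -/

/-- Baer's criterion frees the extension property from the universe of the test modules. -/
theorem IsInjectiveCogenerator.baer {A : Type u} [Ring A] {E : Type v} [AddCommGroup E] [Module A E]
    (hE : IsInjectiveCogenerator A E) : Module.Baer A E := by
  intro I g
  let eI := ULift.moduleEquiv.{u, u, v} (R := A) (M := I)
  let eA := ULift.moduleEquiv.{u, u, v} (R := A) (M := A)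
  obtain ⟨h, hh⟩ := hE.extends_along_injective (ULift.{v} I) (ULift.{v} A)
    (eA.symm.toLinearMap ∘ₗ I.subtype ∘ₗ eI.toLinearMap)
    (eA.symm.injective.comp (Subtype.val_injective.comp eI.injective)) (g ∘ₗ eI.toLinearMap)
  exact ⟨h ∘ₗ eA.symm.toLinearMap, fun x hx => congr($hh ⟨⟨x, hx⟩⟩)⟩

theorem Module.Baer.exists_comp_eq_of_ker_le {A E P P' : Type*} [Ring A] [AddCommGroup E]
    [Module A E] [AddCommGroup P] [Module A P] [AddCommGroup P'] [Module A P']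
    (hE : Module.Baer A E) (u : P →ₗ[A] P') (δ : P →ₗ[A] E)
    (h : LinearMap.ker u ≤ LinearMap.ker δ) : ∃ δ' : P' →ₗ[A] E, δ' ∘ₗ u = δ := by
  obtain ⟨δ', hδ'⟩ := hE.extension_property ((LinearMap.ker u).liftQ u le_rfl)
    (LinearMap.ker_eq_bot.mp (Submodule.ker_liftQ_eq_bot _ _ _ le_rfl))
    ((LinearMap.ker u).liftQ δ h)
  exact ⟨δ', LinearMap.ext fun p => congr($hδ' (Submodule.Quotient.mk p))⟩

theorem IsInjectiveCogenerator.exists_le_ker_apply_ne_zero {A : Type u} [Ring A] {E : Type v}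
    [AddCommGroup E] [Module A E] (hE : IsInjectiveCogenerator A E) {M : Type*} [AddCommGroup M]
    [Module A M] (U : Submodule A M) {m : M} (hm : m ∉ U) :
    ∃ y : M →ₗ[A] E, U ≤ LinearMap.ker y ∧ y m ≠ 0 := by
  -- The separation hypothesis applies to a lift of the cyclic module `A ⧸ ker u`, which embeds in
  -- `M ⧸ U`; injectivity then extends the functional.
  let u : A →ₗ[A] M ⧸ U := LinearMap.toSpanSingleton A _ (U.mkQ m)
  have h1 : (ULift.up ((LinearMap.ker u).mkQ 1) : ULift.{v} (A ⧸ LinearMap.ker u)) ≠ 0 := by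
    intro h
    have h' : (LinearMap.ker u).mkQ 1 = 0 := congrArg ULift.down h
    have hu : (1 : A) ∈ LinearMap.ker u := by simpa using h'
    exact hm (by simpa [u] using hu)
  obtain ⟨f, hf⟩ := hE.separates _ _ h1
  obtain ⟨δ', hδ'⟩ := hE.baer.exists_comp_eq_of_ker_le u
    (f ∘ₗ ULift.moduleEquiv.symm.toLinearMap ∘ₗ (LinearMap.ker u).mkQ) (by
      intro a ha
      have : (LinearMap.ker u).mkQ a = 0 := by simpa using ha
      simp only [LinearMap.mem_ker, LinearMap.comp_apply, this, map_zero])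
  refine ⟨δ' ∘ₗ U.mkQ, ?_, ?_⟩
  · intro a ha
    have : U.mkQ a = 0 := by simpa using ha
    simp only [LinearMap.mem_ker, LinearMap.comp_apply, this, map_zero]
  · have h := congr($hδ' 1)
    have hu : u 1 = U.mkQ m := by simp [u]
    rw [LinearMap.comp_apply, hu] at h
    rw [LinearMap.comp_apply, h]
    exact hf

/-! ### An Ellis–Numakura lemma for linearly compact semigroups -/

/-- A subset of `T`, identified with the dual `P →ₗ[A] E` by `θ`, is closed if it consists of all
elements whose functionals have a prescribed restriction to some submodule `W` of `P`. The
restriction is given as that of the functional of an element `γ`, so closed sets are nonempty. -/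
def IsDualClosed {A E P T : Type*} [Ring A] [AddCommGroup E] [Module A E] [AddCommGroup P]
    [Module A P] (θ : T ≃ (P →ₗ[A] E)) (C : Set T) : Prop :=
  ∃ (γ : T) (W : Submodule A P), C = {g | ∀ w ∈ W, θ g w = θ γ w}

section DualClosed

variable {A E P T : Type*} [Ring A] [AddCommGroup E] [Module A E] [AddCommGroup P] [Module A P]
  {θ : T ≃ (P →ₗ[A] E)}

theorem IsDualClosed.nonempty {C : Set T} (hC : IsDualClosed θ C) : C.Nonempty := by
  obtain ⟨γ, W, rfl⟩ := hC
  exact ⟨γ, fun _ _ => rfl⟩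

theorem IsDualClosed.inter {C D : Set T} (hC : IsDualClosed θ C) (hD : IsDualClosed θ D)
    (h : (C ∩ D).Nonempty) : IsDualClosed θ (C ∩ D) := by
  obtain ⟨γ, W, rfl⟩ := hC
  obtain ⟨δ, V, rfl⟩ := hD
  obtain ⟨x, hx, hx'⟩ := h
  refine ⟨x, W ⊔ V, Set.ext fun g => ⟨?_, fun hg => ⟨fun w hw => ?_, fun w hw => ?_⟩⟩⟩
  · rintro ⟨h₁, h₂⟩ w hw
    obtain ⟨a, ha, b, hb, rfl⟩ := Submodule.mem_sup.mp hw
    rw [map_add, map_add, h₁ a ha, h₂ b hb, hx a ha, hx' b hb]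
  · rw [hg w (Submodule.mem_sup_left hw), hx w hw]
  · rw [hg w (Submodule.mem_sup_right hw), hx' w hw]

theorem le_toPMap_top_iff (p : P →ₗ.[A] E) (k : P →ₗ[A] E) :
    p ≤ k.toPMap ⊤ ↔ ∀ x : p.domain, k x = p x := by
  constructor
  · intro h x
    exact (h.2 (x := x) (y := ⟨x, trivial⟩) rfl).symm
  · intro h
    refine ⟨fun _ _ => trivial, fun x y hxy => ?_⟩
    rw [← h x, hxy]
    rfl

/-- The compactness of `T`, in the form that Zorn's lemma needs: partial functionals are ordered by
extension, and the set of total extensions of a partial functional is closed. -/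
theorem exists_minimal_isDualClosed (hE : Module.Baer A E) (Q : Set T → Prop)
    (hQ : ∀ F : Set (Set T), F.Nonempty → (∀ C ∈ F, Q C) → Q (⋂₀ F))
    {C₀ : Set T} (hC₀ : IsDualClosed θ C₀) (hQ₀ : Q C₀) :
    ∃ C ⊆ C₀, IsDualClosed θ C ∧ Q C ∧ ∀ D ⊆ C, IsDualClosed θ D → Q D → D = C := by
  let ext (p : P →ₗ.[A] E) : Set T := {g | p ≤ (θ g).toPMap ⊤}
  have mem_ext (p : P →ₗ.[A] E) (g : T) : g ∈ ext p ↔ ∀ x : p.domain, θ g x = p x :=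
    le_toPMap_top_iff p (θ g)
  have ext_toPMap (γ : T) (W : Submodule A P) :
      ext ((θ γ).toPMap W) = {g | ∀ w ∈ W, θ g w = θ γ w} := by
    ext g
    rw [mem_ext]
    exact ⟨fun h w hw => h ⟨w, hw⟩, fun h w => h w w.2⟩
  obtain ⟨γ, W, rfl⟩ := hC₀
  obtain ⟨p, hp₀, hp⟩ := zorn_le_nonempty₀ {p : P →ₗ.[A] E | Q (ext p)} (by
    intro c hc hchain y hy
    refine ⟨LinearPMap.sSup c hchain.directedOn, ?_, fun z hz => LinearPMap.le_sSup _ hz⟩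
    have : ext (LinearPMap.sSup c hchain.directedOn) = ⋂₀ (ext '' c) := by
      ext g
      simp only [Set.sInter_image, Set.mem_iInter]
      exact ⟨fun h p hp => (LinearPMap.le_sSup hchain.directedOn hp).trans h,
        fun h => LinearPMap.sSup_le _ h⟩
    rw [Set.mem_ofPred_eq, this]
    exact hQ _ ⟨_, y, hy, rfl⟩ (by rintro _ ⟨p, hp, rfl⟩; exact hc hp))
    ((θ γ).toPMap W) (by rwa [Set.mem_ofPred_eq, ext_toPMap])
  refine ⟨ext p, ?_, ?_, hp.prop, ?_⟩
  · rw [← ext_toPMap]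
    exact fun g hg => hp₀.trans hg
  · obtain ⟨k, hk⟩ := hE.extension_property p.domain.subtype Subtype.val_injective p.toFun
    refine ⟨θ.symm k, p.domain, Set.ext fun g => ?_⟩
    have hk' : ∀ x : p.domain, k x = p x := fun x => congr($hk x)
    rw [mem_ext, Set.mem_ofPred_eq, θ.apply_symm_apply]
    exact ⟨fun h w hw => by rw [h ⟨w, hw⟩, ← hk'], fun h w => by rw [h w w.2, hk']⟩
  · rintro D hD hDc hQD
    obtain ⟨δ, V, rfl⟩ := hDc
    have hδ : δ ∈ ext p := hD (fun _ _ => rfl)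
    -- The submodule `V` need not contain the domain of `p`, but it may be enlarged by it.
    have hr : ext ((θ δ).toPMap (p.domain ⊔ V)) = {g | ∀ w ∈ V, θ g w = θ δ w} := by
      rw [ext_toPMap]
      ext g
      refine ⟨fun h w hw => h w (Submodule.mem_sup_right hw), fun h w hw => ?_⟩
      obtain ⟨a, ha, b, hb, rfl⟩ := Submodule.mem_sup.mp hw
      rw [map_add, map_add, h b hb, (mem_ext p g).mp (hD h) ⟨a, ha⟩,
        (mem_ext p δ).mp hδ ⟨a, ha⟩]
    have hle : p ≤ (θ δ).toPMap (p.domain ⊔ V) := by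
      refine ⟨fun x hx => Submodule.mem_sup_left hx, fun x y hxy => ?_⟩
      rw [← (mem_ext p δ).mp hδ x, hxy]
      rfl
    refine hD.antisymm fun g hg => ?_
    rw [← hr]
    exact (hp.le_of_ge (by rwa [Set.mem_ofPred_eq, hr]) hle).trans hg

variable [Monoid T] {H : T → P →ₗ[A] P}

theorem IsDualClosed.image_mul_right (hE : Module.Baer A E)
    (hH : ∀ g h, θ (g * h) = θ g ∘ₗ H h) {C : Set T} (hC : IsDualClosed θ C) (h : T) :
    IsDualClosed θ ((· * h) '' C) := by
  obtain ⟨γ, W, rfl⟩ := hC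
  refine ⟨γ * h, W.comap (H h), Set.ext fun k => ⟨?_, fun hk => ?_⟩⟩
  · rintro ⟨g, hg, rfl⟩ w hw
    simp only [hH, LinearMap.comp_apply]
    exact hg _ hw
  -- A functional that vanishes on `W.comap (H h)` factors through a functional that vanishes on `W`.
  · obtain ⟨δ, hδ⟩ := hE.exists_comp_eq_of_ker_le (W.mkQ ∘ₗ H h) (θ k - θ (γ * h)) (by
      intro w hw
      have hw' : H h w ∈ W := by simpa using hw
      simp [hk w hw'])
    refine ⟨θ.symm (θ γ + δ ∘ₗ W.mkQ), fun w hw => ?_, θ.injective ?_⟩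
    · have : W.mkQ w = 0 := by simpa using hw
      rw [θ.apply_symm_apply, LinearMap.add_apply, LinearMap.comp_apply, this, map_zero, add_zero]
    · simp only [hH, θ.apply_symm_apply, LinearMap.add_comp, LinearMap.comp_assoc, hδ]
      abel

theorem exists_isIdempotentElem_of_isDualClosed (hE : Module.Baer A E)
    (hH : ∀ g h, θ (g * h) = θ g ∘ₗ H h) {L : Set T} (hL : IsDualClosed θ L)
    (hmul : ∀ a ∈ L, ∀ b ∈ L, a * b ∈ L) : ∃ e ∈ L, IsIdempotentElem e := by
  obtain ⟨C, hCL, hC, hCmul, hmin⟩ := exists_minimal_isDualClosed hE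
    (fun C => ∀ a ∈ C, ∀ b ∈ C, a * b ∈ C)
    (fun F _ hF a ha b hb C hC => hF C hC a (ha C hC) b (hb C hC)) hL hmul
  obtain ⟨h, hh⟩ := hC.nonempty
  have h₁ : (· * h) '' C = C := by
    refine hmin _ ?_ (hC.image_mul_right hE hH h) ?_
    · rintro _ ⟨a, ha, rfl⟩
      exact hCmul a ha h hh
    · rintro _ ⟨a, ha, rfl⟩ _ ⟨b, hb, rfl⟩
      exact ⟨a * h * b, hCmul _ (hCmul a ha h hh) b hb, by simp only [mul_assoc]⟩
  obtain ⟨g, hg, hgh⟩ : h ∈ (· * h) '' C := h₁.symm.subset hh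
  have hstab : IsDualClosed θ {k | k * h = h} := by
    refine ⟨g, LinearMap.range (H h), Set.ext fun k => ?_⟩
    have hθ : θ g ∘ₗ H h = θ h := by rw [← hH]; exact congrArg θ hgh
    rw [Set.mem_ofPred_eq, ← θ.injective.eq_iff, hH, ← hθ]
    exact ⟨fun hk => by rintro _ ⟨p, rfl⟩; exact congr($hk p),
      fun hk => LinearMap.ext fun p => hk _ ⟨p, rfl⟩⟩
  have h₂ : C ∩ {k | k * h = h} = C :=
    hmin _ Set.inter_subset_left (hC.inter hstab ⟨g, hg, hgh⟩)
      (fun a ha b hb => ⟨hCmul a ha.1 b hb.1, by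
        rw [Set.mem_ofPred_eq, mul_assoc, hb.2, ha.2]⟩)
  exact ⟨h, hCL hh, (h₂.symm.subset hh).2⟩

/-- The idempotent lies in a minimal closed left ideal `L` of `B`. For `h ∈ B` the set `B * (h * e)`
is a closed left ideal inside `L`, so it is all of `L`. -/
theorem exists_isIdempotentElem_forall_mul_mul_eq (hE : Module.Baer A E)
    (hH : ∀ g h, θ (g * h) = θ g ∘ₗ H h) {B : Set T} (hB : IsDualClosed θ B)
    (hmul : ∀ a ∈ B, ∀ b ∈ B, a * b ∈ B) :
    ∃ e ∈ B, IsIdempotentElem e ∧ ∀ h ∈ B, ∃ g ∈ B, g * h * e = e := by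
  obtain ⟨L, hLB, hL, hLmul, hmin⟩ := exists_minimal_isDualClosed hE
    (fun C => ∀ a ∈ B, ∀ b ∈ C, a * b ∈ C)
    (fun F _ hF a ha b hb C hC => hF C hC a ha b (hb C hC)) hB hmul
  obtain ⟨e, heL, he⟩ := exists_isIdempotentElem_of_isDualClosed hE hH hL
    (fun a ha b hb => hLmul a (hLB ha) b hb)
  refine ⟨e, hLB heL, he, fun h hh => ?_⟩
  have : (· * (h * e)) '' B = L := by
    refine hmin _ ?_ (hB.image_mul_right hE hH _) ?_
    · rintro _ ⟨a, ha, rfl⟩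
      exact hLmul a ha _ (hLmul h hh e heL)
    · rintro a ha _ ⟨b, hb, rfl⟩
      exact ⟨a * b, hmul a ha b hb, by simp only [mul_assoc]⟩
  obtain ⟨g, hg, hge⟩ : e ∈ (· * (h * e)) '' B := this.symm.subset heL
  exact ⟨g, hg, by rw [mul_assoc]; exact hge⟩

end DualClosed

/-! ### Endomorphisms of the dual as functionals on a balanced tensor product -/

section DualTensor

variable (R S M E : Type*) [Ring R] [Ring S] [AddCommGroup M] [Module R M] [Module Sᵐᵒᵖ M]
  [SMulCommClass Sᵐᵒᵖ R M] [AddCommGroup E] [Module Sᵐᵒᵖ E]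

/-- The relations that define `X ⊗_R M`, for `X = Hom_S(M, E)`, as a quotient of the right
`S`-module `X →₀ M`. -/
noncomputable def dualTensorRel : Submodule Sᵐᵒᵖ (HomDual S M E →₀ M) :=
  Submodule.span Sᵐᵒᵖ
    ({p | ∃ (x y : HomDual S M E) (m : M),
        p = Finsupp.single (x + y) m - (Finsupp.single x m + Finsupp.single y m)} ∪
      {p | ∃ (c : Rᵈᵐᵃ) (x : HomDual S M E) (m : M),
        p = Finsupp.single (c • x) m - Finsupp.single x (DomMulAct.mk.symm c • m)})

/-- The right `S`-module `X ⊗_R M`, for the right `R`-module `X = Hom_S(M, E)`. It is built by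
hand because Mathlib's tensor product is defined only over commutative semirings. -/
abbrev DualTensor := (HomDual S M E →₀ M) ⧸ dualTensorRel R S M E

variable {S M E}

/-- The map `m ↦ x ⊗ m`. -/
noncomputable def dualTmul (x : HomDual S M E) : M →ₗ[Sᵐᵒᵖ] DualTensor R S M E :=
  (dualTensorRel R S M E).mkQ ∘ₗ Finsupp.lsingle x

variable {R}

theorem dualTmul_add (x y : HomDual S M E) (m : M) :
    dualTmul R (x + y) m = dualTmul R x m + dualTmul R y m := by
  refine (Submodule.Quotient.eq _).mpr ?_
  exact Submodule.subset_span (Or.inl ⟨x, y, m, rfl⟩)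

theorem dualTmul_smul (c : Rᵈᵐᵃ) (x : HomDual S M E) (m : M) :
    dualTmul R (c • x) m = dualTmul R x (DomMulAct.mk.symm c • m) := by
  refine (Submodule.Quotient.eq _).mpr ?_
  exact Submodule.subset_span (Or.inr ⟨c, x, m, rfl⟩)

theorem DualTensor.hom_ext {Y : Type*} [AddCommGroup Y] [Module Sᵐᵒᵖ Y]
    {φ ψ : DualTensor R S M E →ₗ[Sᵐᵒᵖ] Y}
    (h : ∀ x m, φ (dualTmul R x m) = ψ (dualTmul R x m)) : φ = ψ := by
  refine Submodule.linearMap_qext _ (Finsupp.lhom_ext fun x m => h x m)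

/-- The linear map on `X ⊗_R M` induced by a balanced family of linear maps. -/
noncomputable def DualTensor.lift {Y : Type*} [AddCommGroup Y] [Module Sᵐᵒᵖ Y]
    (φ : HomDual S M E → M →ₗ[Sᵐᵒᵖ] Y) (hadd : ∀ x y m, φ (x + y) m = φ x m + φ y m)
    (hsmul : ∀ (c : Rᵈᵐᵃ) x m, φ (c • x) m = φ x (DomMulAct.mk.symm c • m)) :
    DualTensor R S M E →ₗ[Sᵐᵒᵖ] Y :=
  (dualTensorRel R S M E).liftQ (Finsupp.lsum ℕ φ) (by
    refine Submodule.span_le.mpr ?_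
    rintro _ (⟨x, y, m, rfl⟩ | ⟨c, x, m, rfl⟩)
    · rw [SetLike.mem_coe, LinearMap.mem_ker, map_sub, map_add]
      simp only [Finsupp.lsum_single, hadd, sub_self]
    · rw [SetLike.mem_coe, LinearMap.mem_ker, map_sub]
      simp only [Finsupp.lsum_single, hsmul, sub_self])

theorem DualTensor.lift_tmul {Y : Type*} [AddCommGroup Y] [Module Sᵐᵒᵖ Y]
    (φ : HomDual S M E → M →ₗ[Sᵐᵒᵖ] Y) (hadd : ∀ x y m, φ (x + y) m = φ x m + φ y m)
    (hsmul : ∀ (c : Rᵈᵐᵃ) x m, φ (c • x) m = φ x (DomMulAct.mk.symm c • m))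
    (x : HomDual S M E) (m : M) :
    DualTensor.lift φ hadd hsmul (dualTmul R x m) = φ x m :=
  Finsupp.lsum_single ℕ φ x m

/-- The functoriality of `X ⊗_R M` in `X`. -/
noncomputable def DualTensor.map (h : Module.End Rᵈᵐᵃ (HomDual S M E)) :
    DualTensor R S M E →ₗ[Sᵐᵒᵖ] DualTensor R S M E :=
  DualTensor.lift (fun x => dualTmul R (h x)) (fun x y m => by rw [map_add, dualTmul_add])
    (fun c x m => by rw [map_smul, dualTmul_smul])

theorem DualTensor.map_tmul (h : Module.End Rᵈᵐᵃ (HomDual S M E)) (x : HomDual S M E) (m : M) :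
    DualTensor.map h (dualTmul R x m) = dualTmul R (h x) m :=
  DualTensor.lift_tmul (R := R) ..

/-- The functional `x ⊗ m ↦ g x m` of an endomorphism `g`. -/
noncomputable def DualTensor.functional (g : Module.End Rᵈᵐᵃ (HomDual S M E)) :
    DualTensor R S M E →ₗ[Sᵐᵒᵖ] E :=
  DualTensor.lift (fun x => g x) (fun x y m => by rw [map_add, LinearMap.add_apply])
    (fun c x m => by rw [map_smul, DomMulAct.smul_linearMap_apply])

theorem DualTensor.functional_tmul (g : Module.End Rᵈᵐᵃ (HomDual S M E)) (x : HomDual S M E)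
    (m : M) : DualTensor.functional g (dualTmul R x m) = g x m :=
  DualTensor.lift_tmul (R := R) ..

/-- The tensor-hom adjunction `End_R(X) ≃ Hom_S(X ⊗_R M, E)` for `X = Hom_S(M, E)`. -/
noncomputable def dualEndEquiv :
    Module.End Rᵈᵐᵃ (HomDual S M E) ≃ (DualTensor R S M E →ₗ[Sᵐᵒᵖ] E) where
  toFun := DualTensor.functional
  invFun δ :=
    { toFun := fun x => δ ∘ₗ dualTmul R x
      map_add' := fun x y => LinearMap.ext fun m => by simp [dualTmul_add]
      map_smul' := fun c x => LinearMap.ext fun m => by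
        simp [dualTmul_smul, DomMulAct.smul_linearMap_apply] }
  left_inv g := LinearMap.ext fun x => LinearMap.ext fun m => DualTensor.functional_tmul g x m
  right_inv δ := DualTensor.hom_ext fun x m => DualTensor.functional_tmul _ x m

theorem dualEndEquiv_tmul (g : Module.End Rᵈᵐᵃ (HomDual S M E)) (x : HomDual S M E) (m : M) :
    dualEndEquiv g (dualTmul R x m) = g x m :=
  DualTensor.functional_tmul g x m

theorem dualEndEquiv_mul (g h : Module.End Rᵈᵐᵃ (HomDual S M E)) :
    dualEndEquiv (g * h) = dualEndEquiv g ∘ₗ DualTensor.map h :=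
  DualTensor.hom_ext fun x m => by
    rw [LinearMap.comp_apply, DualTensor.map_tmul, dualEndEquiv_tmul, dualEndEquiv_tmul]
    rfl

/-! ### Annihilators of elements of the dual -/

theorem ker_dualTmul_le_ker (x : HomDual S M E) :
    LinearMap.ker (dualTmul R x) ≤ LinearMap.ker x := by
  intro m hm
  rw [LinearMap.mem_ker] at hm ⊢
  rw [← Module.End.one_apply (R := Rᵈᵐᵃ) x, ← dualEndEquiv_tmul, hm, map_zero]

theorem ker_dualTmul_le_ker_dualTmul_apply (g : Module.End Rᵈᵐᵃ (HomDual S M E))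
    (x : HomDual S M E) : LinearMap.ker (dualTmul R x) ≤ LinearMap.ker (dualTmul R (g x)) := by
  intro m hm
  rw [LinearMap.mem_ker] at hm ⊢
  rw [← DualTensor.map_tmul, hm, map_zero]

theorem exists_end_apply_eq (hE : Module.Baer Sᵐᵒᵖ E) {x y : HomDual S M E}
    (h : LinearMap.ker (dualTmul R x) ≤ LinearMap.ker y) :
    ∃ g : Module.End Rᵈᵐᵃ (HomDual S M E), g x = y := by
  obtain ⟨δ, hδ⟩ := hE.exists_comp_eq_of_ker_le _ y h
  exact ⟨dualEndEquiv.symm δ, hδ⟩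

variable (R) in
theorem exists_maximal_ker_tmul (hE : IsInjectiveCogenerator Sᵐᵒᵖ E) {m₀ : M} (hm₀ : m₀ ≠ 0) :
    ∃ f : HomDual S M E, f m₀ ≠ 0 ∧ ∀ y : HomDual S M E, y m₀ ≠ 0 →
      LinearMap.ker (dualTmul R f) ≤ LinearMap.ker (dualTmul R y) →
      LinearMap.ker (dualTmul R y) ≤ LinearMap.ker (dualTmul R f) := by
  obtain ⟨y₀, -, hy₀⟩ := hE.exists_le_ker_apply_ne_zero (⊥ : Submodule Sᵐᵒᵖ M) (m := m₀) (by simpa)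
  obtain ⟨_, -, ⟨f, hf, rfl⟩, hmax⟩ := zorn_le_nonempty₀
    {V : Submodule Sᵐᵒᵖ M | ∃ x : HomDual S M E, x m₀ ≠ 0 ∧ LinearMap.ker (dualTmul R x) = V} (by
      intro c hc hchain V hV
      have hU : m₀ ∉ sSup c := by
        rw [Submodule.mem_sSup_of_directed ⟨V, hV⟩ hchain.directedOn]
        rintro ⟨W, hW, hmW⟩
        obtain ⟨x, hx, rfl⟩ := hc hW
        exact hx (ker_dualTmul_le_ker x hmW)
      obtain ⟨y, hy, hym⟩ := hE.exists_le_ker_apply_ne_zero (sSup c) hU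
      refine ⟨_, ⟨y, hym, rfl⟩, fun W hW => ?_⟩
      obtain ⟨x, hx, rfl⟩ := hc hW
      -- As `y` kills `ker (dualTmul R x)`, it is a multiple of `x`.
      obtain ⟨g, rfl⟩ := exists_end_apply_eq (R := R) hE.baer ((le_sSup hW).trans hy)
      exact ker_dualTmul_le_ker_dualTmul_apply g x) _ ⟨y₀, hy₀, rfl⟩
  exact ⟨f, hf, fun y hy h => hmax ⟨y, hy, rfl⟩ h⟩

theorem isDualClosed_stabilizer (f : HomDual S M E) :
    IsDualClosed dualEndEquiv {g : Module.End Rᵈᵐᵃ (HomDual S M E) | g f = f} := by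
  refine ⟨1, LinearMap.range (dualTmul R f), Set.ext fun g => ⟨fun hg => ?_, fun hg => ?_⟩⟩
  · rintro _ ⟨m, rfl⟩
    rw [dualEndEquiv_tmul, dualEndEquiv_tmul, Set.mem_ofPred_eq.mp hg, Module.End.one_apply]
  · refine LinearMap.ext fun m => ?_
    have := hg _ ⟨m, rfl⟩
    rwa [dualEndEquiv_tmul, dualEndEquiv_tmul, Module.End.one_apply] at this

/-- Suppose that `q` kills a nonzero `a` fixed by `e`. Then `f` is not a multiple `g₀ (q f)`, since
`g₀ * q` would fix `f` but not be injective on the range of `e`. So the annihilator of `q f` is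
strictly larger than that of `f`, and maximality applies. -/
theorem apply_eq_zero_of_apply_eq_zero (hE : Module.Baer Sᵐᵒᵖ E) {m₀ : M} {f : HomDual S M E}
    (hmax : ∀ y : HomDual S M E, y m₀ ≠ 0 →
      LinearMap.ker (dualTmul R f) ≤ LinearMap.ker (dualTmul R y) →
      LinearMap.ker (dualTmul R y) ≤ LinearMap.ker (dualTmul R f))
    {e : Module.End Rᵈᵐᵃ (HomDual S M E)}
    (he : ∀ h : Module.End Rᵈᵐᵃ (HomDual S M E), h f = f →
      ∃ g : Module.End Rᵈᵐᵃ (HomDual S M E), g * h * e = e)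
    (q : Module.End Rᵈᵐᵃ (HomDual S M E)) {a : HomDual S M E} (ha : a ≠ 0) (hea : e a = a)
    (hqa : q a = 0) : q f m₀ = 0 := by
  by_contra hne
  have hle := hmax (q f) hne (ker_dualTmul_le_ker_dualTmul_apply q f)
  obtain ⟨g₀, hg₀⟩ := exists_end_apply_eq hE (hle.trans (ker_dualTmul_le_ker f))
  obtain ⟨g, hg⟩ := he (g₀ * q) hg₀
  apply ha
  have h := congr($hg a)
  simp only [Module.End.mul_apply, hea, hqa, map_zero] at h
  exact h.symm

end DualTensor

theorem theorem3p3 {R S M E : Type*} [Ring R] [Ring S]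
    [AddCommGroup M] [Module R M] [Module Sᵐᵒᵖ M] [SMulCommClass Sᵐᵒᵖ R M]
    [AddCommGroup E] [Module Sᵐᵒᵖ E]
    (hE : IsInjectiveCogenerator Sᵐᵒᵖ E) (hM : Nontrivial M) :
    ∃ N N' : Submodule Rᵈᵐᵃ (HomDual S M E),
      IsCompl N N' ∧ IsIndecomposableModule Rᵈᵐᵃ N := by
  obtain ⟨m₀, hm₀⟩ := exists_ne (0 : M)
  obtain ⟨f, hf, hmax⟩ := exists_maximal_ker_tmul R hE hm₀
  obtain ⟨e, hef, he, hmin⟩ := exists_isIdempotentElem_forall_mul_mul_eq hE.baer dualEndEquiv_mul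
    (isDualClosed_stabilizer (R := R) f) (fun a ha b hb => by
      rw [Set.mem_ofPred_eq, Module.End.mul_apply, Set.mem_ofPred_eq.mp hb, Set.mem_ofPred_eq.mp ha])
  have hvanish := fun q : Module.End Rᵈᵐᵃ (HomDual S M E) => fun a : HomDual S M E =>
    apply_eq_zero_of_apply_eq_zero (a := a) hE.baer hmax
      (fun h hh => (hmin h hh).imp fun g hg => hg.2) q
  refine ⟨LinearMap.range e, LinearMap.ker e, LinearMap.IsIdempotentElem.isCompl he, ?_, ?_⟩
  · refine ⟨⟨⟨f, f, hef⟩, 0, fun h => hf ?_⟩⟩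
    rw [show f = 0 from congrArg Subtype.val h, LinearMap.zero_apply]
  · intro A B hAB
    by_contra! hne
    obtain ⟨a, haA, ha⟩ := Submodule.exists_mem_ne_zero_of_ne_bot hne.1
    obtain ⟨b, hbB, hb⟩ := Submodule.exists_mem_ne_zero_of_ne_bot hne.2
    have hfix : ∀ n : LinearMap.range e, e n = n := fun n =>
      (LinearMap.IsIdempotentElem.mem_range_iff he).mp n.2
    -- The projections of the range of `e` onto `A` and `B`, extended by zero on the kernel of `e`.
    let pA : Module.End Rᵈᵐᵃ (HomDual S M E) :=
      (LinearMap.range e).subtype ∘ₗ A.projection B hAB ∘ₗ e.rangeRestrict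
    let pB : Module.End Rᵈᵐᵃ (HomDual S M E) :=
      (LinearMap.range e).subtype ∘ₗ B.projection A hAB.symm ∘ₗ e.rangeRestrict
    have hrestrict : ∀ n : LinearMap.range e, e.rangeRestrict n = n := fun n =>
      Subtype.ext (hfix n)
    have hpA : pA f m₀ = 0 := hvanish pA b (by simpa using hb) (hfix b) (by
      simp only [pA, LinearMap.comp_apply, hrestrict]
      rw [(Submodule.projection_apply_eq_zero_iff hAB).mpr hbB, map_zero])
    have hpB : pB f m₀ = 0 := hvanish pB a (by simpa using ha) (hfix a) (by
      simp only [pB, LinearMap.comp_apply, hrestrict]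
      rw [(Submodule.projection_apply_eq_zero_iff hAB.symm).mpr haA, map_zero])
    have hsum : pA f + pB f = f := by
      simp only [pA, pB, LinearMap.comp_apply]
      rw [← map_add, Submodule.projection_add_projection_eq_self]
      exact hef
    apply hf
    rw [← hsum, LinearMap.add_apply, hpA, hpB, add_zero]
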